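/- Fix $L>0$ and put $\omega_L=\frac{2\pi^2}{L^2+2\pi^2}$ and $\Omega_L=-\frac{4\pi^2}{L^2}$. For $\omega<1$ consider the equation $$\phi''=\frac{\omega-\phi^2}{1-\phi^2}\,\phi ,\qquad \phi:\mathbb R\to(-1,1). \qquad (*)$$ By a periodic profile we mean a $C^\infty$ solution $\phi:\mathbb R\to(-1,1)$ of $(*)$ that is nonconstant and has least positive period $L$. (i) For every $\omega\in(\omega_L,1)$ there is a periodic profile $\phi$ with $0<\phi(x)<1$ for all $x\in\mathbb R$ such that, for every $x_0\in\mathbb R$, the translate $\phi(\cdot-x_0)$ is again a periodic profile and is even about $x_0$; that is, $\phi(x-x_0)=\phi(x_0-x)$ for all $x\in\mathbb R$. (ii) For every $\omega\in(\Omega_L,1)$ there is a periodic profile $\phi$ with $-1<\phi(x)<1$ for all $x\in\mathbb R$ such that, for every $x_0\in\mathbb R$, the translate $\phi(\cdot-x_0)$ is again a periodic profile, is odd about $x_0$, and is symmetric about the quarter period $x_0+\frac L4$; that is, $\phi(x-x_0)=-\phi(x_0-x)=\phi\left(\frac L2-x+x_0\right)$ for all $x\in\mathbb R$. -/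

import Mathlib

noncomputable section

/-- The threshold `ω_L = 2π² / (L² + 2π²)`. -/
def evenThreshold (L : ℝ) : ℝ := 2 * Real.pi ^ 2 / (L ^ 2 + 2 * Real.pi ^ 2)

/-- The threshold `Ω_L = -4π² / L²`. -/
def oddThreshold (L : ℝ) : ℝ := -(4 * Real.pi ^ 2 / L ^ 2)

/-- `L` is the least positive period of `f`. A constant function has no such period,
so that stationary points of the system are not periodic orbits. -/
def HasMinimalPeriod (f : ℝ → ℝ) (L : ℝ) : Prop :=
  IsLeast {T : ℝ | 0 < T ∧ Function.Periodic f T} L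

/-- `φ` is the smooth profile of a periodic orbit, with (least) period `L`, of
`φ'' = (ω - φ²) φ / (1 - φ²)`. -/
structure IsPeriodicProfile (ω L : ℝ) (φ : ℝ → ℝ) : Prop where
  smooth : ContDiff ℝ (⊤ : ℕ∞) φ
  period : HasMinimalPeriod φ L
  ode : ∀ x, deriv (deriv φ) x = (ω - φ x ^ 2) / (1 - φ x ^ 2) * φ x

/-- An even wave centred at `x₀`: values in `(0, 1)`, even about `x₀`. -/
structure IsEvenWave (ω L x₀ : ℝ) (φ : ℝ → ℝ) : Prop extends IsPeriodicProfile ω L φ where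
  range : ∀ x, 0 < φ x ∧ φ x < 1
  even : ∀ x, φ (x₀ + x) = φ (x₀ - x)

/-- An odd wave centred at `x₀`: values in `(-1, 1)`, odd about `x₀`, and symmetric about
the quarter period `x₀ + L / 4`. -/
structure IsOddWave (ω L x₀ : ℝ) (φ : ℝ → ℝ) : Prop extends IsPeriodicProfile ω L φ where
  range : ∀ x, -1 < φ x ∧ φ x < 1
  odd : ∀ x, φ (x₀ + x) = -φ (x₀ - x)
  quarter : ∀ x, φ (x₀ + x) = φ (x₀ + (L / 2 - x))

end

open Real Set Filter Topology MeasureTheory Function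

/-!
A solution moves on an energy level `u' ^ 2 = u ^ 2 + (1 - ω) * log (1 - u ^ 2) + E`. Parametrize a
closed level by an angle which runs with positive speed: the solution is recovered from the motion
of the angle, and its period is the integral of the inverse speed over a full turn, which depends
continuously on the level. Along the odd waves the period tends to `0` as the amplitude tends to
`1`; along the even waves it starts from the period `√2 * π * √((1 - ω) / ω)` of small oscillations
about `√ω`. At the separatrix the speed vanishes to first order at one angle, so the period
diverges; for `ω < 0` there is no separatrix, and the odd waves shrink instead to the small
oscillations about `0`, of period `2 * π / √(-ω)`. By the intermediate value theorem every period in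
between occurs.

Both families are labelled so that the separatrix is where the strictly decreasing function
`z ↦ (1 - exp (-z)) / z` takes the value `1 - ω`.
-/

section ConservationOfEnergy

lemma hasDerivAt_of_hasDerivAt_sq {𝕜 : Type*} [NontriviallyNormedField 𝕜] [NeZero (2 : 𝕜)]
    {v : 𝕜 → 𝕜} {v' t : 𝕜} (hv : ContinuousAt v t) (ht : v t ≠ 0)
    (h : HasDerivAt (fun s => v s ^ 2) (2 * v t * v') t) : HasDerivAt v v' t := by
  have hsum : Tendsto (fun s => v s + v t) (𝓝[≠] t) (𝓝 (2 * v t)) :=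
    two_mul (v t) ▸ (hv.tendsto.mono_left nhdsWithin_le_nhds).add_const _
  have h2 : 2 * v t ≠ 0 := mul_ne_zero two_ne_zero ht
  rw [hasDerivAt_iff_tendsto_slope] at h ⊢
  have hquot := h.div hsum h2
  rw [mul_div_cancel_left₀ _ h2] at hquot
  refine hquot.congr' ?_
  filter_upwards [hsum.eventually_ne h2] with s hs
  rw [Pi.div_apply, slope_def_field, slope_def_field, sq_sub_sq, mul_div_assoc,
    mul_div_cancel_left₀ _ hs]

/-- At the turning points, where `v` vanishes, nothing can be read off from the energy equation;
the fundamental theorem of calculus bridges these countably many points. -/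
lemma hasDerivAt_velocity_of_sq_eq {u v F P : ℝ → ℝ} (hv : Continuous v)
    (hu : ∀ t, HasDerivAt u (v t) t) (hsq : ∀ t, v t ^ 2 = P (u t))
    (hP : ∀ t, HasDerivAt P (2 * F (u t)) (u t)) (hF : Continuous fun t => F (u t))
    (hz : {t | v t = 0}.Countable) (t : ℝ) : HasDerivAt v (F (u t)) t := by
  have hmoving : ∀ s, v s ≠ 0 → HasDerivAt v (F (u s)) s := fun s hs => by
    refine hasDerivAt_of_hasDerivAt_sq hv.continuousAt hs ?_
    simp only [hsq]
    exact ((hP s).comp s (hu s)).congr_deriv (by ring)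
  have hint : ∀ s, v s = v 0 + ∫ x in (0 : ℝ)..s, F (u x) := fun s => by
    rw [integral_eq_of_hasDerivAt_off_countable v _ hz hv.continuousOn
      (fun x hx => hmoving x hx.2) (hF.intervalIntegrable _ _), add_sub_cancel]
  rw [funext hint]
  exact (hF.integral_hasStrictDerivAt 0 t).hasDerivAt.const_add _

lemma contDiff_of_hasDerivAt_of_hasDerivAt {u v F : ℝ → ℝ} {s : Set ℝ} {n : ℕ∞}
    (hF : ContDiffOn ℝ n F s) (hu : ∀ t, HasDerivAt u (v t) t)
    (hv : ∀ t, HasDerivAt v (F (u t)) t) (hs : ∀ t, u t ∈ s) : ContDiff ℝ n u := by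
  refine contDiff_iff_contDiffAt.2 fun t => ?_
  have hfield : ContDiffOn ℝ n (uncurry fun _ (p : ℝ × ℝ) => (p.2, F p.1))
      (Icc (t - 1) (t + 1) ×ˢ (Prod.fst ⁻¹' s)) :=
    contDiff_snd.snd.contDiffOn.prodMk (hF.comp contDiff_snd.fst.contDiffOn fun _ hp => hp.2)
  have hcurve := ODE.contDiffOn_enat_Icc_of_hasDerivWithinAt hfield
    (fun r _ => ((hu r).prodMk (hv r)).hasDerivWithinAt) (fun r _ => hs r)
  have hnhds : Icc (t - 1) (t + 1) ∈ 𝓝 t := Icc_mem_nhds (by linarith) (by linarith)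
  exact contDiff_fst.contDiffAt.comp t (hcurve.contDiffAt hnhds)

lemma isPeriodicProfile_of_sq_eq {ω L E : ℝ} {u v : ℝ → ℝ} (hv : Continuous v)
    (hu : ∀ t, HasDerivAt u (v t) t) (hlt : ∀ t, u t ^ 2 < 1)
    (hsq : ∀ t, v t ^ 2 = u t ^ 2 + (1 - ω) * log (1 - u t ^ 2) + E)
    (hz : {t | v t = 0}.Countable) (hper : HasMinimalPeriod u L) : IsPeriodicProfile ω L u := by
  have hne : ∀ x : ℝ, x ^ 2 < 1 → 1 - x ^ 2 ≠ 0 := fun x hx => (sub_pos.2 hx).ne'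
  have hforce : ContDiffOn ℝ (⊤ : ℕ∞) (fun x : ℝ => (ω - x ^ 2) / (1 - x ^ 2) * x)
      {x | x ^ 2 < 1} := ((by fun_prop : ContDiffOn ℝ _ (fun x : ℝ => ω - x ^ 2) _).div
        (by fun_prop) hne).mul contDiffOn_id
  have hpotential : ∀ t, HasDerivAt (fun x => x ^ 2 + (1 - ω) * log (1 - x ^ 2) + E)
      (2 * ((ω - u t ^ 2) / (1 - u t ^ 2) * u t)) (u t) := fun t => by
    have hpow := hasDerivAt_pow 2 (u t)
    refine ((hpow.add (((hpow.const_sub 1).log (hne _ (hlt t))).const_mul (1 - ω))).add_const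
      E).congr_deriv ?_
    have := hne _ (hlt t)
    field_simp
    ring
  have hucont : Continuous u := continuous_iff_continuousAt.2 fun t => (hu t).continuousAt
  have hv' := hasDerivAt_velocity_of_sq_eq (F := fun x => (ω - x ^ 2) / (1 - x ^ 2) * x) hv hu hsq
    hpotential (hforce.continuousOn.comp_continuous hucont hlt) hz
  refine ⟨contDiff_of_hasDerivAt_of_hasDerivAt hforce hu hv' hlt, hper, fun x => ?_⟩
  rw [funext fun t => (hu t).deriv, (hv' x).deriv]

end ConservationOfEnergy

section Motion

/-- The time at which a point moving on the line, with speed `G θ` when it is at `θ`, reaches `θ`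
after having started from `0`. It is meaningful for continuous positive `G`. -/
noncomputable def arrivalTime (G : ℝ → ℝ) (θ : ℝ) : ℝ := ∫ x in (0 : ℝ)..θ, (G x)⁻¹

/-- `Θ t` is the position at time `t` of a point which moves on the line with speed `G` and is at
`0` at time `0`. -/
structure IsMotion (G Θ : ℝ → ℝ) : Prop where
  hasDerivAt : ∀ t, HasDerivAt Θ (G (Θ t)) t
  arrivalTime_apply : ∀ t, arrivalTime G (Θ t) = t
  apply_arrivalTime : ∀ θ, Θ (arrivalTime G θ) = θ

variable {G Θ : ℝ → ℝ} {P : ℝ}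

lemma arrivalTime_zero (G : ℝ → ℝ) : arrivalTime G 0 = 0 := intervalIntegral.integral_same

lemma arrivalTime_const (c θ : ℝ) : arrivalTime (fun _ => c) θ = θ / c := by
  simp [arrivalTime, div_eq_mul_inv]

lemma intervalIntegrable_inv (hG : Continuous G) (hpos : ∀ θ, 0 < G θ) (a b : ℝ) :
    IntervalIntegrable (fun x => (G x)⁻¹) volume a b :=
  (hG.inv₀ fun x => (hpos x).ne').intervalIntegrable _ _

lemma hasDerivAt_arrivalTime (hG : Continuous G) (hpos : ∀ θ, 0 < G θ) (θ : ℝ) :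
    HasDerivAt (arrivalTime G) (G θ)⁻¹ θ :=
  ((hG.inv₀ fun x => (hpos x).ne').integral_hasStrictDerivAt 0 θ).hasDerivAt

lemma strictMono_arrivalTime (hG : Continuous G) (hpos : ∀ θ, 0 < G θ) :
    StrictMono (arrivalTime G) :=
  strictMono_of_deriv_pos fun θ => by
    rw [(hasDerivAt_arrivalTime hG hpos θ).deriv]
    exact inv_pos.2 (hpos θ)

lemma arrivalTime_le_arrivalTime {H : ℝ → ℝ} (hG : Continuous G) (hpos : ∀ θ, 0 < G θ)
    (hH : Continuous H) (hle : ∀ θ, G θ ≤ H θ) (hP : 0 ≤ P) :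
    arrivalTime H P ≤ arrivalTime G P :=
  intervalIntegral.integral_mono_on hP
    (intervalIntegrable_inv hH (fun θ => (hpos θ).trans_le (hle θ)) _ _)
    (intervalIntegrable_inv hG hpos _ _) fun θ _ => inv_anti₀ (hpos θ) (hle θ)

lemma arrivalTime_add (hG : Continuous G) (hpos : ∀ θ, 0 < G θ) (hper : Periodic G P) (θ : ℝ) :
    arrivalTime G (θ + P) = arrivalTime G θ + arrivalTime G P := by
  have h := (hper.comp Inv.inv).intervalIntegral_add_eq θ 0
  rw [zero_add] at h
  simp only [comp_apply] at h
  unfold arrivalTime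
  rw [← h, intervalIntegral.integral_add_adjacent_intervals] <;>
    exact intervalIntegrable_inv hG hpos _ _

lemma arrivalTime_sub {a : ℝ} (hG : Continuous G) (hpos : ∀ θ, 0 < G θ)
    (hsymm : ∀ θ, G (a - θ) = G θ) (θ : ℝ) :
    arrivalTime G (a - θ) = arrivalTime G a - arrivalTime G θ := by
  have h := intervalIntegral.integral_comp_sub_left (fun x => (G x)⁻¹) a (a := 0) (b := θ)
  simp only [hsymm, sub_zero] at h
  unfold arrivalTime
  rw [h, eq_sub_iff_add_eq, intervalIntegral.integral_add_adjacent_intervals] <;>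
    exact intervalIntegrable_inv hG hpos _ _

lemma arrivalTime_half (hG : Continuous G) (hpos : ∀ θ, 0 < G θ) (hsymm : ∀ θ, G (P - θ) = G θ) :
    arrivalTime G (P / 2) = arrivalTime G P / 2 := by
  have h := arrivalTime_sub hG hpos hsymm (P / 2)
  rw [sub_half] at h
  linarith

lemma surjective_arrivalTime (hG : Continuous G) (hpos : ∀ θ, 0 < G θ) (hper : Periodic G P)
    (hP : 0 < P) : Surjective (arrivalTime G) := by
  have hper' : Periodic (fun x => (G x)⁻¹) P := hper.comp Inv.inv
  have hint := intervalIntegrable_inv hG hpos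
  have hinv : ∀ x, 0 < (G x)⁻¹ := fun x => inv_pos.2 (hpos x)
  refine Continuous.surjective ?_ (hper'.tendsto_atTop_intervalIntegral_of_pos' (hint _ _) hinv hP)
    (hper'.tendsto_atBot_intervalIntegral_of_pos' (hint _ _) hinv hP)
  exact continuous_iff_continuousAt.2 fun θ => (hasDerivAt_arrivalTime hG hpos θ).continuousAt

lemma exists_isMotion (hG : Continuous G) (hpos : ∀ θ, 0 < G θ) (hper : Periodic G P)
    (hP : 0 < P) : ∃ Θ, IsMotion G Θ := by
  let e := (strictMono_arrivalTime hG hpos).orderIsoOfSurjective _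
    (surjective_arrivalTime hG hpos hper hP)
  have he : ∀ t, arrivalTime G (e.symm t) = t := e.apply_symm_apply
  refine ⟨e.symm, fun t => ?_, he, e.symm_apply_apply⟩
  simpa only [inv_inv] using HasDerivAt.of_local_left_inverse e.symm.continuous.continuousAt
    (hasDerivAt_arrivalTime hG hpos (e.symm t)) (inv_pos.2 (hpos _)).ne' (Eventually.of_forall he)

namespace IsMotion

lemma continuous (hΘ : IsMotion G Θ) : Continuous Θ :=
  continuous_iff_continuousAt.2 fun t => (hΘ.hasDerivAt t).continuousAt

lemma strictMono (hΘ : IsMotion G Θ) (hpos : ∀ θ, 0 < G θ) : StrictMono Θ :=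
  strictMono_of_deriv_pos fun t => by
    rw [(hΘ.hasDerivAt t).deriv]
    exact hpos _

lemma apply_add (hΘ : IsMotion G Θ) (hG : Continuous G) (hpos : ∀ θ, 0 < G θ)
    (hper : Periodic G P) (t : ℝ) : Θ (t + arrivalTime G P) = Θ t + P := by
  rw [← hΘ.apply_arrivalTime (Θ t + P), arrivalTime_add hG hpos hper, hΘ.arrivalTime_apply]

lemma apply_sub {a : ℝ} (hΘ : IsMotion G Θ) (hG : Continuous G) (hpos : ∀ θ, 0 < G θ)
    (hsymm : ∀ θ, G (a - θ) = G θ) (t : ℝ) : Θ (arrivalTime G a - t) = a - Θ t := by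
  rw [← hΘ.apply_arrivalTime (a - Θ t), arrivalTime_sub hG hpos hsymm, hΘ.arrivalTime_apply]

lemma apply_neg (hΘ : IsMotion G Θ) (hG : Continuous G) (hpos : ∀ θ, 0 < G θ)
    (heven : ∀ θ, G (-θ) = G θ) (t : ℝ) : Θ (-t) = -Θ t := by
  simpa [arrivalTime_zero] using hΘ.apply_sub (a := 0) hG hpos (by simpa using heven) t

lemma hasMinimalPeriod_comp {w : ℝ → ℝ} {θ₀ : ℝ} (hΘ : IsMotion G Θ) (hG : Continuous G)
    (hpos : ∀ θ, 0 < G θ) (hper : Periodic G P) (hP : 0 < P) (hw : Periodic w P)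
    (hne : ∀ θ ∈ Ioo θ₀ (θ₀ + P), w θ ≠ w θ₀) :
    HasMinimalPeriod (fun t => w (Θ t)) (arrivalTime G P) := by
  have hmono := hΘ.strictMono hpos
  refine ⟨⟨?_, fun t => ?_⟩, fun T ⟨hT, hTper⟩ => ?_⟩
  · simpa [arrivalTime_zero] using strictMono_arrivalTime hG hpos hP
  · simp only [hΘ.apply_add hG hpos hper, hw (Θ t)]
  · by_contra! hlt
    have hΘ₀ := hΘ.apply_arrivalTime θ₀
    have hreturn := hTper (arrivalTime G θ₀)
    simp only [hΘ₀] at hreturn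
    refine hne _ ⟨?_, ?_⟩ hreturn
    · exact hΘ₀.symm.trans_lt (hmono (by linarith))
    · rw [← hΘ₀, ← hΘ.apply_add hG hpos hper, hΘ₀]
      exact hmono (by linarith)

end IsMotion

end Motion

section ArrivalTimeInFamilies

variable {X : Type*} [TopologicalSpace X] {G : X → ℝ → ℝ}

lemma continuousOn_arrivalTime [FirstCountableTopology X] (hG : Continuous (uncurry G)) (P : ℝ) :
    ContinuousOn (fun p => arrivalTime (G p) P) {p | ∀ θ, 0 < G p θ} := by
  rw [continuousOn_iff_continuous_domRestrict]
  refine intervalIntegral.continuous_parametric_intervalIntegral_of_continuous'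
    (f := fun (p : {p | ∀ θ, 0 < G p θ}) θ => (G p θ)⁻¹) ?_ 0 P
  exact (hG.comp (continuous_subtype_val.prodMap continuous_id)).inv₀ fun z => (z.1.2 z.2).ne'

lemma lintegral_enorm_inv_eq_top {g : ℝ → ℝ} {θ₀ P : ℝ} (h0 : 0 ≤ θ₀) (hP : θ₀ < P)
    (hg : g =O[𝓝[>] θ₀] fun θ => θ - θ₀) : ∫⁻ θ in Ioc 0 P, ‖g θ‖ₑ⁻¹ = ⊤ := by
  obtain ⟨C, hC, hCg⟩ := hg.exists_pos
  obtain ⟨θ₁, hθ₁, hIoc⟩ := mem_nhdsGT_iff_exists_Ioc_subset.1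
    (inter_mem hCg.bound (Ioc_mem_nhdsGT hP))
  have hbound : ∀ θ ∈ Ioc θ₀ θ₁, ‖C⁻¹ * (θ - θ₀)⁻¹‖ₑ ≤ ‖g θ‖ₑ⁻¹ := fun θ hθ => by
    have hle : ‖g θ‖ₑ ≤ ‖C * (θ - θ₀)‖ₑ := by
      rw [enorm_le_iff_norm_le, norm_mul, norm_of_nonneg hC.le]
      exact (hIoc hθ).1
    rw [← mul_inv, enorm_inv (mul_pos hC (sub_pos.2 hθ.1)).ne']
    exact ENNReal.inv_le_inv.2 hle
  have hdiv : ¬ IntegrableOn (fun θ => C⁻¹ * (θ - θ₀)⁻¹) (Ioc θ₀ θ₁) := fun hint => by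
    have hint' := (intervalIntegrable_iff_integrableOn_Ioc_of_le (mem_Ioi.1 hθ₁).le).2
      (hint.const_mul C)
    simp only [mul_inv_cancel_left₀ hC.ne', intervalIntegrable_sub_inv_iff, left_mem_uIcc,
      not_true_eq_false, or_false] at hint'
    exact (mem_Ioi.1 hθ₁).ne hint'
  refine top_unique ?_
  calc ⊤ = ∫⁻ θ in Ioc θ₀ θ₁, ‖C⁻¹ * (θ - θ₀)⁻¹‖ₑ := by
        by_contra hfin
        exact hdiv ⟨by fun_prop, Ne.lt_top (Ne.symm hfin)⟩
    _ ≤ ∫⁻ θ in Ioc θ₀ θ₁, ‖g θ‖ₑ⁻¹ := setLIntegral_mono' measurableSet_Ioc hbound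
    _ ≤ ∫⁻ θ in Ioc 0 P, ‖g θ‖ₑ⁻¹ :=
        lintegral_mono_set fun θ hθ => ⟨h0.trans_lt hθ.1, (hIoc hθ).2.2⟩

lemma ofReal_arrivalTime {g : ℝ → ℝ} {P : ℝ} (hg : Continuous g) (hpos : ∀ θ, 0 < g θ)
    (hP : 0 ≤ P) : ENNReal.ofReal (arrivalTime g P) = ∫⁻ θ in Ioc 0 P, ‖g θ‖ₑ⁻¹ := by
  have hint := (intervalIntegrable_iff_integrableOn_Ioc_of_le hP).1
    (intervalIntegrable_inv hg hpos 0 P)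
  rw [arrivalTime, intervalIntegral.integral_of_le hP, ofReal_integral_eq_lintegral_ofReal hint
    (Eventually.of_forall fun θ => (inv_pos.2 (hpos θ)).le)]
  refine lintegral_congr fun θ => ?_
  rw [← enorm_inv (hpos θ).ne', enorm_of_nonneg (inv_pos.2 (hpos θ)).le]

/-- Fatou's lemma: the speed vanishes to first order in the limit, so the travel time diverges. -/
lemma tendsto_arrivalTime_atTop [FirstCountableTopology X] (hG : Continuous (uncurry G)) {q : X}
    {θ₀ P : ℝ} (h0 : 0 ≤ θ₀) (hP : θ₀ < P) (hq : G q =O[𝓝[>] θ₀] fun θ => θ - θ₀) :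
    Tendsto (fun p => arrivalTime (G p) P) (𝓝[{p | ∀ θ, 0 < G p θ}] q) atTop := by
  rw [← ENNReal.tendsto_ofReal_nhds_top]
  rcases eq_or_neBot (𝓝[{p | ∀ θ, 0 < G p θ}] q) with hbot | hne
  · rw [hbot]
    exact tendsto_bot
  have hlim : ∀ θ, Tendsto (fun p => ‖G p θ‖ₑ⁻¹) (𝓝[{p | ∀ θ, 0 < G p θ}] q) (𝓝 ‖G q θ‖ₑ⁻¹) :=
    fun θ => ((hG.uncurry_right θ).enorm.inv.tendsto q).mono_left nhdsWithin_le_nhds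
  have hfatou : ⊤ ≤ liminf (fun p => ∫⁻ θ in Ioc 0 P, ‖G p θ‖ₑ⁻¹)
      (𝓝[{p | ∀ θ, 0 < G p θ}] q) := by
    rw [← lintegral_enorm_inv_eq_top h0 hP hq]
    simp only [← (hlim _).liminf_eq]
    exact lintegral_liminf_le fun p => (hG.uncurry_left p).enorm.measurable.inv
  refine (tendsto_of_le_liminf_of_limsup_le hfatou le_top).congr' ?_
  filter_upwards [self_mem_nhdsWithin] with p hp
  exact (ofReal_arrivalTime (hG.uncurry_left p) hp (h0.trans hP.le)).symm

lemma isBigO_sqrt_comp_cos {f : ℝ → ℝ} (hf : DifferentiableAt ℝ f (-1)) (h0 : f (-1) = 0) :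
    (fun θ => √(f (cos θ))) =O[𝓝 π] fun θ => θ - π := by
  have hlin : (fun θ => f (cos θ)) =O[𝓝 π] fun θ => cos θ + 1 := by
    have hcos : Tendsto cos (𝓝 π) (𝓝 (-1)) := cos_pi ▸ continuous_cos.tendsto π
    have h := hf.isBigO_sub
    simp only [h0, sub_zero, sub_neg_eq_add] at h
    exact h.comp_tendsto hcos
  have hquad : (fun θ => cos θ + 1) =O[𝓝 π] fun θ => (θ - π) ^ 2 := by
    refine .of_bound' (Eventually.of_forall fun θ => ?_)
    rw [norm_of_nonneg (by linarith [neg_one_le_cos θ]), norm_of_nonneg (sq_nonneg _)]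
    have := one_sub_sq_div_two_le_cos (x := θ - π)
    rw [cos_sub_pi] at this
    nlinarith [sq_nonneg (θ - π)]
  have hsqrt := (hlin.trans hquad).sqrt (Eventually.of_forall fun θ => sq_nonneg _)
  simpa only [sqrt_sq_eq_abs, Asymptotics.isBigO_abs_right] using hsqrt

end ArrivalTimeInFamilies

section ExponentialMoments

/-- The `n`-th moment of the density `exp (-(z * t))` on the unit interval. The moments of order `0`
and `1` are the quotients `(1 - exp (-z)) / z` and `(1 - (1 + z) * exp (-z)) / z ^ 2`, continued to
`z = 0`. -/
noncomputable def expMoment (n : ℕ) (z : ℝ) : ℝ := ∫ t in (0 : ℝ)..1, t ^ n * exp (-(z * t))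

lemma hasDerivAt_expMoment (n : ℕ) (z : ℝ) :
    HasDerivAt (expMoment n) (-expMoment (n + 1) z) z := by
  have hexp : ProbabilityTheory.integrableExpSet id (volume.restrict (Ioc (0 : ℝ) 1)) = univ :=
    eq_univ_of_forall fun t => ProbabilityTheory.integrable_exp_mul_of_mem_Icc aemeasurable_id
      ((ae_restrict_mem measurableSet_Ioc).mono fun x hx => Ioc_subset_Icc_self hx)
  have hint : -z ∈ interior
      (ProbabilityTheory.integrableExpSet id (volume.restrict (Ioc (0 : ℝ) 1))) := by
    simp only [hexp, interior_univ, mem_univ]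
  have h := (ProbabilityTheory.hasDerivAt_integral_pow_mul_exp_real hint n).scomp z
    (hasDerivAt_neg z)
  unfold expMoment
  simpa only [intervalIntegral.integral_of_le zero_le_one, id, comp_def, neg_mul,
    smul_eq_mul, one_mul] using h

lemma continuous_expMoment (n : ℕ) : Continuous (expMoment n) :=
  continuous_iff_continuousAt.2 fun z => (hasDerivAt_expMoment n z).continuousAt

lemma expMoment_pos (n : ℕ) (z : ℝ) : 0 < expMoment n z :=
  intervalIntegral.intervalIntegral_pos_of_pos_on
    (Continuous.intervalIntegrable (by fun_prop) _ _)
    (fun t ht => mul_pos (pow_pos ht.1 n) (exp_pos _)) zero_lt_one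

lemma strictAnti_expMoment (n : ℕ) : StrictAnti (expMoment n) := fun z w hzw =>
  intervalIntegral.integral_lt_integral_of_continuousOn_of_le_of_exists_lt zero_lt_one
    (by fun_prop) (by fun_prop)
    (fun t ht => mul_le_mul_of_nonneg_left
      (exp_le_exp.2 (neg_le_neg (mul_le_mul_of_nonneg_right hzw.le ht.1.le)))
      (pow_nonneg ht.1.le n))
    ⟨1, right_mem_Icc.2 zero_le_one, by simpa using hzw⟩

lemma expMoment_apply_zero (n : ℕ) : expMoment n 0 = 1 / (n + 1) := by
  simp [expMoment]

lemma mul_expMoment_zero (z : ℝ) : z * expMoment 0 z = 1 - exp (-z) := by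
  have hderiv : ∀ t : ℝ, HasDerivAt (fun t => -exp (-(z * t))) (z * (t ^ 0 * exp (-(z * t)))) t :=
    fun t => ((hasDerivAt_const_mul z).fun_neg.exp.fun_neg).congr_deriv (by ring)
  rw [expMoment, ← intervalIntegral.integral_const_mul,
    intervalIntegral.integral_eq_sub_of_hasDerivAt (fun t _ => hderiv t)
      (Continuous.intervalIntegrable (by fun_prop) _ _)]
  simp only [mul_one, mul_zero, neg_zero, exp_zero]
  ring

lemma mul_expMoment_succ (n : ℕ) (z : ℝ) :
    z * expMoment (n + 1) z = (n + 1) * expMoment n z - exp (-z) := by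
  have hderiv : ∀ t : ℝ, HasDerivAt (fun t => t ^ (n + 1) * exp (-(z * t)))
      ((n + 1) * (t ^ n * exp (-(z * t))) - z * (t ^ (n + 1) * exp (-(z * t)))) t := fun t =>
    ((hasDerivAt_pow (n + 1) t).mul (hasDerivAt_const_mul z).fun_neg.exp).congr_deriv (by
      push_cast
      ring)
  have hint : ∀ (c : ℝ) (k : ℕ),
      IntervalIntegrable (fun t : ℝ => c * (t ^ k * exp (-(z * t)))) volume 0 1 :=
    fun c k => Continuous.intervalIntegrable (by fun_prop) _ _
  have h := intervalIntegral.integral_eq_sub_of_hasDerivAt (fun t _ => hderiv t)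
    ((hint _ _).sub (hint _ _))
  rw [intervalIntegral.integral_sub (hint _ _) (hint _ _), intervalIntegral.integral_const_mul,
    intervalIntegral.integral_const_mul] at h
  simp only [one_pow, one_mul, mul_one, zero_pow n.succ_ne_zero, zero_mul, sub_zero] at h
  unfold expMoment
  linarith

lemma expMoment_zero_neg (z : ℝ) : expMoment 0 (-z) = exp z * expMoment 0 z := by
  rcases eq_or_ne z 0 with rfl | hz
  · simp
  have h := mul_expMoment_zero (-z)
  rw [neg_neg] at h
  refine mul_left_cancel₀ hz ?_
  rw [mul_left_comm, mul_expMoment_zero, mul_sub, ← exp_add, add_neg_cancel, exp_zero]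
  linarith

lemma tendsto_expMoment_zero_atTop : Tendsto (expMoment 0) atTop (𝓝 0) := by
  refine squeeze_zero' (Eventually.of_forall fun z => (expMoment_pos 0 z).le) ?_
    tendsto_inv_atTop_zero
  filter_upwards [eventually_gt_atTop 0] with z hz
  rw [inv_eq_one_div, le_div_iff₀' hz, mul_expMoment_zero]
  linarith [exp_pos (-z)]

lemma exists_expMoment_zero_eq {c : ℝ} (hc : 0 < c) (hc1 : c ≤ 1) :
    ∃ z, 0 ≤ z ∧ expMoment 0 z = c := by
  have h0 : expMoment 0 0 = 1 := by simp [expMoment_apply_zero]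
  exact isPreconnected_Ici.intermediate_value_Ioc self_mem_Ici
    (le_principal_iff.2 (Ici_mem_atTop 0)) (continuous_expMoment 0).continuousOn
    tendsto_expMoment_zero_atTop ⟨hc, by rwa [h0]⟩

end ExponentialMoments

lemma countable_setOf_sin_eq_zero : {θ : ℝ | sin θ = 0}.Countable := by
  simp only [sin_eq_zero_iff]
  exact countable_range _

lemma countable_setOf_cos_eq_zero : {θ : ℝ | cos θ = 0}.Countable := by
  simp only [← sin_add_pi_div_two]
  exact countable_setOf_sin_eq_zero.preimage (add_left_injective _)

section OddWave

/-- The squared angular speed, at an angle of cosine `x`, of the odd wave of amplitude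
`√(1 - exp (-s))`: the value of `u' ^ 2 / (√(1 - exp (-s)) * x) ^ 2` on the energy level, for
`c = 1 - ω`. Expressing it by `expMoment` cancels the zeros of numerator and denominator. -/
noncomputable def oddSpeedSq (c s x : ℝ) : ℝ :=
  c * exp s / expMoment 0 (-log (1 + (exp s - 1) * x ^ 2)) - 1

/-- The angular speed, at the angle `θ`, of the odd wave of amplitude `√(1 - exp (-s))`. -/
noncomputable def oddSpeed (c s θ : ℝ) : ℝ := √(oddSpeedSq c s (cos θ))

variable {c s L : ℝ}

lemma one_add_exp_sub_one_mul_sq_pos (s : ℝ) {x : ℝ} (hx : x ^ 2 ≤ 1) :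
    0 < 1 + (exp s - 1) * x ^ 2 := by
  rcases hx.eq_or_lt with h | h
  · simpa [h] using exp_pos s
  · nlinarith [mul_nonneg (exp_pos s).le (sq_nonneg x)]

lemma continuous_oddSpeed (c : ℝ) : Continuous (uncurry (oddSpeed c)) := by
  have hlog : Continuous fun p : ℝ × ℝ => log (1 + (exp p.1 - 1) * cos p.2 ^ 2) :=
    Continuous.log (by fun_prop) fun p =>
      (one_add_exp_sub_one_mul_sq_pos p.1 (cos_sq_le_one p.2)).ne'
  exact (((by fun_prop : Continuous fun p : ℝ × ℝ => c * exp p.1).div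
    ((continuous_expMoment 0).comp hlog.neg) fun p => (expMoment_pos 0 _).ne').sub
    continuous_const).sqrt

lemma oddSpeed_neg (c s θ : ℝ) : oddSpeed c s (-θ) = oddSpeed c s θ := by
  rw [oddSpeed, cos_neg, oddSpeed]

lemma oddSpeed_pi_sub (c s θ : ℝ) : oddSpeed c s (π - θ) = oddSpeed c s θ := by
  rw [oddSpeed, oddSpeed, cos_pi_sub, oddSpeedSq, oddSpeedSq, neg_sq]

lemma periodic_oddSpeed (c s : ℝ) : Periodic (oddSpeed c s) (2 * π) := fun θ => by
  rw [oddSpeed, cos_add_two_pi, oddSpeed]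

lemma oddSpeed_two_pi_sub (c s θ : ℝ) : oddSpeed c s (2 * π - θ) = oddSpeed c s θ := by
  rw [oddSpeed, cos_two_pi_sub, oddSpeed]

lemma oddSpeedSq_neg_one (c s : ℝ) : oddSpeedSq c s (-1) = c / expMoment 0 s - 1 := by
  rw [oddSpeedSq, neg_one_sq, mul_one, add_sub_cancel, log_exp, expMoment_zero_neg, mul_comm,
    mul_div_mul_left _ _ (exp_pos s).ne']

lemma oddSpeed_zero (c θ : ℝ) : oddSpeed c 0 θ = √(c - 1) := by
  simp [oddSpeed, oddSpeedSq, expMoment_apply_zero]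

lemma differentiableAt_oddSpeedSq (c s : ℝ) : DifferentiableAt ℝ (oddSpeedSq c s) (-1) := by
  have hlog : DifferentiableAt ℝ (fun x : ℝ => log (1 + (exp s - 1) * x ^ 2)) (-1) :=
    DifferentiableAt.log (by fun_prop) (one_add_exp_sub_one_mul_sq_pos s (by norm_num)).ne'
  exact ((differentiableAt_const _).div
    ((hasDerivAt_expMoment 0 _).differentiableAt.comp _ hlog.neg)
    (expMoment_pos 0 _).ne').sub_const 1

lemma oddSpeedSq_neg_one_le (hc : 0 ≤ c) (hs : 0 ≤ s) {x : ℝ} (hx : x ^ 2 ≤ 1) :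
    oddSpeedSq c s (-1) ≤ oddSpeedSq c s x := by
  have hle : log (1 + (exp s - 1) * x ^ 2) ≤ log (1 + (exp s - 1) * (-1) ^ 2) :=
    log_le_log (one_add_exp_sub_one_mul_sq_pos s hx) (by nlinarith [one_le_exp hs])
  exact sub_le_sub_right (div_le_div_of_nonneg_left (mul_nonneg hc (exp_pos s).le)
    (expMoment_pos 0 _) ((strictAnti_expMoment 0).antitone (neg_le_neg hle))) 1

lemma sqrt_le_oddSpeed (hc : 0 ≤ c) (hs : 0 ≤ s) (θ : ℝ) :
    √(c / expMoment 0 s - 1) ≤ oddSpeed c s θ := by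
  rw [← oddSpeedSq_neg_one]
  exact sqrt_le_sqrt (oddSpeedSq_neg_one_le hc hs (cos_sq_le_one θ))

lemma oddSpeed_pos (hs : 0 ≤ s) (h : expMoment 0 s < c) (θ : ℝ) : 0 < oddSpeed c s θ := by
  have hA := expMoment_pos 0 s
  refine lt_of_lt_of_le ?_ (sqrt_le_oddSpeed (hA.trans h).le hs θ)
  exact sqrt_pos.2 (sub_pos.2 ((one_lt_div hA).2 h))

lemma tendsto_arrivalTime_oddSpeed_zero (hc : 0 < c) {P : ℝ} (hP : 0 ≤ P) :
    Tendsto (fun s => arrivalTime (oddSpeed c s) P) atTop (𝓝 0) := by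
  have hA : Tendsto (expMoment 0) atTop (𝓝[>] 0) := tendsto_nhdsWithin_iff.2
    ⟨tendsto_expMoment_zero_atTop, Eventually.of_forall (expMoment_pos 0)⟩
  have hlow : Tendsto (fun s => √(c / expMoment 0 s - 1)) atTop atTop :=
    tendsto_sqrt_atTop.comp (tendsto_atTop_add_const_right _ (-1)
      (hA.inv_tendsto_nhdsGT_zero.const_mul_atTop hc))
  refine squeeze_zero' ?_ ?_ (hlow.const_div_atTop P)
  all_goals
    filter_upwards [eventually_ge_atTop 0, hA.eventually (Ioo_mem_nhdsGT hc)] with s hs hAs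
    have hpos := oddSpeed_pos hs hAs.2
  · exact intervalIntegral.integral_nonneg hP fun θ _ => (inv_pos.2 (hpos θ)).le
  · rw [← arrivalTime_const]
    exact arrivalTime_le_arrivalTime continuous_const
      (fun _ => sqrt_pos.2 (sub_pos.2 ((one_lt_div hAs.1).2 hAs.2)))
      ((continuous_oddSpeed c).uncurry_left s) (sqrt_le_oddSpeed hc.le hs) hP

lemma tendsto_arrivalTime_oddSpeed_atTop (hs : 0 ≤ s) (h : expMoment 0 s = c) :
    Tendsto (fun r => arrivalTime (oddSpeed c r) (2 * π)) (𝓝[>] s) atTop := by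
  have hzero : oddSpeedSq c s (-1) = 0 := by
    rw [oddSpeedSq_neg_one, h, div_self (h ▸ expMoment_pos 0 s).ne', sub_self]
  refine (tendsto_arrivalTime_atTop (continuous_oddSpeed c) pi_pos.le (by linarith [pi_pos])
    ((isBigO_sqrt_comp_cos (differentiableAt_oddSpeedSq c s) hzero).mono
      nhdsWithin_le_nhds)).mono_left (nhdsWithin_mono _ fun r hr => ?_)
  exact oddSpeed_pos (hs.trans (mem_Ioi.1 hr).le) (h ▸ strictAnti_expMoment 0 hr)

lemma exists_arrivalTime_oddSpeed_eq (hc : 0 < c) (hL : 0 < L) (h : (c - 1) * L ^ 2 < (2 * π) ^ 2) :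
    ∃ s, 0 < s ∧ expMoment 0 s < c ∧ arrivalTime (oddSpeed c s) (2 * π) = L := by
  have hcont : ∀ {S : Set ℝ}, (∀ s ∈ S, 0 ≤ s ∧ expMoment 0 s < c) →
      ContinuousOn (fun s => arrivalTime (oddSpeed c s) (2 * π)) S := fun hS =>
    (continuousOn_arrivalTime (continuous_oddSpeed c) _).mono fun s hs =>
      oddSpeed_pos (hS s hs).1 (hS s hs).2
  have hzero := tendsto_arrivalTime_oddSpeed_zero hc two_pi_pos.le
  rcases le_or_gt c 1 with hc1 | hc1
  · obtain ⟨q, hq, hqc⟩ := exists_expMoment_zero_eq hc hc1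
    have hadm : ∀ s ∈ Ioi q, 0 ≤ s ∧ expMoment 0 s < c := fun s hs =>
      ⟨hq.trans (mem_Ioi.1 hs).le, hqc ▸ strictAnti_expMoment 0 hs⟩
    obtain ⟨s, hs, hsL⟩ := isPreconnected_Ioi.intermediate_value_Ioi
      (le_principal_iff.2 (Ioi_mem_atTop q)) (le_principal_iff.2 self_mem_nhdsWithin)
      (hcont hadm) hzero (tendsto_arrivalTime_oddSpeed_atTop hq hqc) hL
    exact ⟨s, hq.trans_lt hs, (hadm s hs).2, hsL⟩
  · have hA0 : expMoment 0 0 = 1 := by simp [expMoment_apply_zero]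
    have hadm : ∀ s ∈ Ici 0, 0 ≤ s ∧ expMoment 0 s < c := fun s hs =>
      ⟨hs, (((strictAnti_expMoment 0).antitone hs).trans_eq hA0).trans_lt hc1⟩
    have hlong : L < arrivalTime (oddSpeed c 0) (2 * π) := by
      have hc0 := sub_pos.2 hc1
      rw [show oddSpeed c 0 = fun _ => √(c - 1) from funext (oddSpeed_zero c), arrivalTime_const,
        lt_div_iff₀ (sqrt_pos.2 hc0)]
      refine lt_of_pow_lt_pow_left₀ 2 two_pi_pos.le ?_
      rwa [mul_pow, sq_sqrt hc0.le, mul_comm]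
    obtain ⟨s, hs, hsL⟩ := isPreconnected_Ici.intermediate_value_Ioc self_mem_Ici
      (le_principal_iff.2 (Ici_mem_atTop 0)) (hcont hadm) hzero ⟨hL, hlong.le⟩
    refine ⟨s, (mem_Ici.1 hs).lt_of_ne ?_, (hadm s hs).2, hsL⟩
    rintro rfl
    exact hlong.ne' hsL

lemma sq_amplitude_mul_cos_mul_oddSpeed {a : ℝ} (ha : a ^ 2 = 1 - exp (-s)) (hs : 0 ≤ s)
    (h : expMoment 0 s < c) (θ : ℝ) :
    (a * cos θ * oddSpeed c s θ) ^ 2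
      = (a * sin θ) ^ 2 + c * log (1 - (a * sin θ) ^ 2) + (c * s - a ^ 2) := by
  set w := log (1 + (exp s - 1) * cos θ ^ 2)
  have hexpw : exp w = 1 + (exp s - 1) * cos θ ^ 2 :=
    exp_log (one_add_exp_sub_one_mul_sq_pos s (cos_sq_le_one θ))
  have hlevel : 1 - (a * sin θ) ^ 2 = exp (w - s) := by
    rw [sub_eq_add_neg w, exp_add, hexpw, mul_pow, ha, sin_sq, exp_neg]
    field_simp
    ring
  have hcos : (a * cos θ) ^ 2 * exp s = w * expMoment 0 (-w) := by
    have hmoment := mul_expMoment_zero (-w)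
    rw [neg_neg, hexpw] at hmoment
    rw [mul_pow, ha, exp_neg]
    field_simp
    linarith
  have hspeed : oddSpeed c s θ ^ 2 = c * exp s / expMoment 0 (-w) - 1 :=
    sq_sqrt (sqrt_pos.1 (oddSpeed_pos hs h θ)).le
  have hA := (expMoment_pos 0 (-w)).ne'
  rw [hlevel, log_exp, mul_pow, hspeed, mul_sub_one, ← mul_div_assoc, mul_left_comm, hcos,
    mul_pow a, mul_pow a, sin_sq]
  field_simp
  ring

lemma isOddWave_of_isMotion {ω a : ℝ} {Θ : ℝ → ℝ} (hs : 0 < s) (hsω : expMoment 0 s < 1 - ω)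
    (ha : 0 < a) (ha2 : a ^ 2 = 1 - exp (-s)) (hΘ : IsMotion (oddSpeed (1 - ω) s) Θ) :
    IsOddWave ω (arrivalTime (oddSpeed (1 - ω) s) (2 * π)) 0 fun t => a * sin (Θ t) := by
  set G := oddSpeed (1 - ω) s
  have hG : Continuous G := (continuous_oddSpeed _).uncurry_left s
  have hpos : ∀ θ, 0 < G θ := oddSpeed_pos hs.le hsω
  have hlt : ∀ θ, (a * sin θ) ^ 2 < 1 := fun θ => by
    rw [mul_pow]
    nlinarith [sin_sq_le_one θ, exp_pos (-s), sq_nonneg a]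
  have hmax : ∀ θ ∈ Ioo (π / 2) (π / 2 + 2 * π), a * sin θ ≠ a * sin (π / 2) := fun θ hθ h => by
    have h1 : cos (θ - π / 2) = 1 := by
      rw [cos_sub_pi_div_two, mul_left_cancel₀ ha.ne' h, sin_pi_div_two]
    rw [cos_eq_one_iff_of_lt_of_lt (by linarith [hθ.1, pi_pos]) (by linarith [hθ.2])] at h1
    exact hθ.1.ne' (sub_eq_zero.1 h1)
  have hprofile : IsPeriodicProfile ω (arrivalTime G (2 * π)) fun t => a * sin (Θ t) := by
    refine isPeriodicProfile_of_sq_eq (v := fun t => a * cos (Θ t) * G (Θ t))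
      (by have := hΘ.continuous; fun_prop) (fun t => ?_) (fun t => hlt _)
      (fun t => sq_amplitude_mul_cos_mul_oddSpeed ha2 hs.le hsω _) ?_
      (hΘ.hasMinimalPeriod_comp hG hpos (periodic_oddSpeed _ s) two_pi_pos
        (fun θ => by rw [sin_add_two_pi]) hmax)
    · exact ((hΘ.hasDerivAt t).sin.const_mul a).congr_deriv (by ring)
    · refine (countable_setOf_cos_eq_zero.preimage (hΘ.strictMono hpos).injective).mono
        fun t ht => ?_
      simpa [ha.ne', (hpos _).ne'] using ht
  have hhalf : arrivalTime G (2 * π) / 2 = arrivalTime G π := by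
    rw [← arrivalTime_half hG hpos (oddSpeed_two_pi_sub _ s), mul_div_cancel_left₀ π two_ne_zero]
  refine ⟨hprofile, fun t => abs_lt.1 ((sq_lt_one_iff_abs_lt_one _).1 (hlt _)), fun t => ?_,
    fun t => ?_⟩
  · simp only [zero_add, zero_sub, hΘ.apply_neg hG hpos (oddSpeed_neg _ s), sin_neg, mul_neg,
      neg_neg]
  · simp only [zero_add, hhalf, hΘ.apply_sub hG hpos (oddSpeed_pi_sub _ s), sin_pi_sub]

lemma exists_isOddWave {ω : ℝ} (hL : 0 < L) (hω : oddThreshold L < ω) (hω1 : ω < 1) :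
    ∃ φ, IsOddWave ω L 0 φ := by
  have hlong : ((1 - ω) - 1) * L ^ 2 < (2 * π) ^ 2 := by
    rw [oddThreshold, neg_lt, lt_div_iff₀ (by positivity)] at hω
    linarith
  obtain ⟨s, hs, hsω, rfl⟩ := exists_arrivalTime_oddSpeed_eq (sub_pos.2 hω1) hL hlong
  obtain ⟨Θ, hΘ⟩ := exists_isMotion ((continuous_oddSpeed _).uncurry_left s)
    (oddSpeed_pos hs.le hsω) (periodic_oddSpeed _ s) two_pi_pos
  have hamp : 0 < 1 - exp (-s) := sub_pos.2 (exp_lt_one_iff.2 (neg_neg_of_pos hs))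
  exact ⟨_, isOddWave_of_isMotion hs hsω (sqrt_pos.2 hamp) (sq_sqrt hamp.le) hΘ⟩

end OddWave

section EvenWave

/-- The square of the even wave as a function of `y = (1 + cos θ) / 2`, for `c = 1 - ω`. At fixed
energy `log (1 - u ^ 2)` oscillates between two turning values, and is affine in `y` here; the
constant factor is determined by the width `d` of that oscillation. -/
noncomputable def evenSq (c d y : ℝ) : ℝ := 1 - c / expMoment 0 d * exp (-(d * y))

/-- The gap between `exp (-(d * y))` and its chord over `[0, 1]`, divided by the factor
`d ^ 2 * y * (1 - y)` which accounts for its zeros; see `mul_chordGap`. -/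
noncomputable def chordGap (d y : ℝ) : ℝ :=
  y * expMoment 1 (d * y) + (1 - y) * (exp (-d) * expMoment 1 (-(d * (1 - y))))

/-- The quotient of the angular speed of the even wave by the value of the wave, as a function of
`y = (1 + cos θ) / 2`. -/
noncomputable def evenSpeedRatio (c d y : ℝ) : ℝ :=
  2 * exp (d * y) * √(chordGap d y / (c / expMoment 0 d))

/-- The value of the even wave at the angle `θ`. -/
noncomputable def evenValue (c d θ : ℝ) : ℝ := √(evenSq c d ((1 + cos θ) / 2))

/-- The angular speed of the even wave at the angle `θ`. -/
noncomputable def evenSpeed (c d θ : ℝ) : ℝ :=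
  evenValue c d θ * evenSpeedRatio c d ((1 + cos θ) / 2)

variable {c d y L : ℝ}

lemma one_add_cos_div_two_mem_Icc (θ : ℝ) : (1 + cos θ) / 2 ∈ Icc (0 : ℝ) 1 :=
  ⟨by linarith [neg_one_le_cos θ], by linarith [cos_le_one θ]⟩

lemma sq_mul_expMoment_one (z : ℝ) : z ^ 2 * expMoment 1 z = 1 - (1 + z) * exp (-z) := by
  have h := mul_expMoment_succ 0 z
  rw [Nat.cast_zero, zero_add, zero_add, one_mul] at h
  rw [sq, mul_assoc, h, mul_sub, mul_expMoment_zero]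
  ring

lemma mul_chordGap (d y : ℝ) :
    d ^ 2 * (y * (1 - y)) * chordGap d y = 1 - y * (1 - exp (-d)) - exp (-(d * y)) := by
  have hleft := sq_mul_expMoment_one (d * y)
  have hright := sq_mul_expMoment_one (-(d * (1 - y)))
  have hexp : exp (-d) * exp (d * (1 - y)) = exp (-(d * y)) := by
    rw [← exp_add]
    ring_nf
  rw [neg_neg] at hright
  rw [chordGap]
  linear_combination (1 - y) * hleft + y * exp (-d) * hright - y * (1 - d * (1 - y)) * hexp

lemma chordGap_pos (d : ℝ) (hy : y ∈ Icc (0 : ℝ) 1) : 0 < chordGap d y := by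
  have hleft : 0 < expMoment 1 (d * y) := expMoment_pos 1 _
  have hright : 0 < exp (-d) * expMoment 1 (-(d * (1 - y))) :=
    mul_pos (exp_pos _) (expMoment_pos 1 _)
  exact convex_Ioi (0 : ℝ) hleft hright hy.1 (sub_nonneg.2 hy.2) (add_sub_cancel y 1)

lemma chordGap_zero (y : ℝ) : chordGap 0 y = 1 / 2 := by
  rw [chordGap, zero_mul, zero_mul, neg_zero, exp_zero, expMoment_apply_zero]
  push_cast
  ring

lemma evenSq_pos (hd : 0 ≤ d) (hc : 0 ≤ c) (h : c < expMoment 0 d) (hy : y ∈ Icc (0 : ℝ) 1) :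
    0 < evenSq c d y := by
  have hA := expMoment_pos 0 d
  refine sub_pos.2 (lt_of_le_of_lt ?_ ((div_lt_one hA).2 h))
  exact mul_le_of_le_one_right (by positivity) (exp_le_one_iff.2 (neg_nonpos.2
    (mul_nonneg hd hy.1)))

lemma evenSq_lt_one (hc : 0 < c) (d y : ℝ) : evenSq c d y < 1 :=
  sub_lt_self _ (mul_pos (div_pos hc (expMoment_pos 0 d)) (exp_pos _))

lemma evenValue_pos (hd : 0 ≤ d) (hc : 0 ≤ c) (h : c < expMoment 0 d) (θ : ℝ) :
    0 < evenValue c d θ :=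
  sqrt_pos.2 (evenSq_pos hd hc h (one_add_cos_div_two_mem_Icc θ))

lemma sq_evenValue (hd : 0 ≤ d) (hc : 0 ≤ c) (h : c < expMoment 0 d) (θ : ℝ) :
    evenValue c d θ ^ 2 = evenSq c d ((1 + cos θ) / 2) :=
  sq_sqrt (evenSq_pos hd hc h (one_add_cos_div_two_mem_Icc θ)).le

lemma evenValue_lt_one (hc : 0 < c) (d θ : ℝ) : evenValue c d θ < 1 :=
  (sqrt_lt' one_pos).2 ((evenSq_lt_one hc d _).trans_eq (one_pow 2).symm)

lemma evenValue_neg (c d θ : ℝ) : evenValue c d (-θ) = evenValue c d θ := by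
  rw [evenValue, cos_neg, evenValue]

lemma periodic_evenValue (c d : ℝ) : Periodic (evenValue c d) (2 * π) := fun θ => by
  rw [evenValue, cos_add_two_pi, evenValue]

lemma evenValue_ne_of_mem_Ioo (hd : 0 < d) (hc : 0 < c) (h : c < expMoment 0 d) {θ : ℝ}
    (hθ : θ ∈ Ioo 0 (2 * π)) : evenValue c d θ ≠ evenValue c d 0 := fun heq => by
  have hκ := div_pos hc (expMoment_pos 0 d)
  have hcos := congrArg (· ^ 2) heq
  simp only [sq_evenValue hd.le hc.le h, evenSq, sub_right_inj, mul_right_inj' hκ.ne',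
    exp_eq_exp, neg_inj, mul_right_inj' hd.ne', cos_zero] at hcos
  have hzero : θ = 0 := (cos_eq_one_iff_of_lt_of_lt (by linarith [hθ.1, pi_pos]) hθ.2).1
    (by linarith)
  exact hθ.1.ne' hzero

lemma continuous_evenSpeedRatio (hc : c ≠ 0) : Continuous (uncurry (evenSpeedRatio c)) := by
  have hA := continuous_expMoment 0
  have hB := continuous_expMoment 1
  have hne : ∀ p : ℝ × ℝ, expMoment 0 p.1 ≠ 0 := fun p => (expMoment_pos 0 p.1).ne'
  unfold uncurry evenSpeedRatio chordGap
  fun_prop (disch := simp [*])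

lemma continuous_evenSpeed (hc : c ≠ 0) : Continuous (uncurry (evenSpeed c)) := by
  have hA := continuous_expMoment 0
  have hne : ∀ p : ℝ × ℝ, expMoment 0 p.1 ≠ 0 := fun p => (expMoment_pos 0 p.1).ne'
  have hratio := (continuous_evenSpeedRatio hc).comp
    (by fun_prop : Continuous fun p : ℝ × ℝ => (p.1, (1 + cos p.2) / 2))
  refine Continuous.mul (Continuous.sqrt ?_) hratio
  unfold evenSq
  fun_prop (disch := simp [*])

lemma evenSpeed_neg (c d θ : ℝ) : evenSpeed c d (-θ) = evenSpeed c d θ := by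
  rw [evenSpeed, cos_neg, evenValue_neg, evenSpeed]

lemma periodic_evenSpeed (c d : ℝ) : Periodic (evenSpeed c d) (2 * π) := fun θ => by
  rw [evenSpeed, cos_add_two_pi, periodic_evenValue, evenSpeed]

lemma evenSpeedRatio_pos (hc : 0 < c) (d : ℝ) (hy : y ∈ Icc (0 : ℝ) 1) :
    0 < evenSpeedRatio c d y := by
  have hA := expMoment_pos 0 d
  have hgap := chordGap_pos d hy
  unfold evenSpeedRatio
  positivity

lemma evenSpeed_pos (hd : 0 ≤ d) (hc : 0 < c) (h : c < expMoment 0 d) (θ : ℝ) :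
    0 < evenSpeed c d θ :=
  mul_pos (evenValue_pos hd hc.le h θ) (evenSpeedRatio_pos hc d (one_add_cos_div_two_mem_Icc θ))

lemma evenSpeed_zero (c θ : ℝ) : evenSpeed c 0 θ = √(1 - c) * (2 * √(1 / 2 / c)) := by
  simp [evenSpeed, evenValue, evenSq, evenSpeedRatio, expMoment_apply_zero, chordGap_zero]

lemma tendsto_arrivalTime_evenSpeed_atTop (h : expMoment 0 d = c) :
    Tendsto (fun r => arrivalTime (evenSpeed c r) (2 * π)) (𝓝[Ico 0 d] d) atTop := by
  have hc : 0 < c := h ▸ expMoment_pos 0 d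
  have hdiff : DifferentiableAt ℝ (fun x => evenSq c d ((1 + x) / 2)) (-1) := by
    unfold evenSq
    fun_prop
  have hzero : evenSq c d ((1 + -1) / 2) = 0 := by
    simp [evenSq, h, hc.ne']
  have hratio : (fun θ => evenSpeedRatio c d ((1 + cos θ) / 2)) =O[𝓝 π] fun _ => (1 : ℝ) :=
    (((continuous_evenSpeedRatio hc.ne').uncurry_left d).comp
      (by fun_prop : Continuous fun θ => (1 + cos θ) / 2)).continuousAt.tendsto.isBigO_one ℝ
  have hO : evenSpeed c d =O[𝓝 π] fun θ => θ - π := by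
    have h := (isBigO_sqrt_comp_cos hdiff hzero).mul hratio
    simp only [mul_one] at h
    exact h
  refine (tendsto_arrivalTime_atTop (continuous_evenSpeed hc.ne') pi_pos.le
    (by linarith [pi_pos]) (hO.mono nhdsWithin_le_nhds)).mono_left
    (nhdsWithin_mono _ fun r hr => ?_)
  exact evenSpeed_pos hr.1 hc (h ▸ strictAnti_expMoment 0 hr.2)

lemma exists_arrivalTime_evenSpeed_eq (hc : 0 < c) (hc1 : c < 1) (hL : 0 < L)
    (h : 2 * π ^ 2 * c < (1 - c) * L ^ 2) :
    ∃ d, 0 < d ∧ c < expMoment 0 d ∧ arrivalTime (evenSpeed c d) (2 * π) = L := by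
  obtain ⟨q, hq, hqc⟩ := exists_expMoment_zero_eq hc hc1.le
  have hadm : ∀ d ∈ Ico 0 q, c < expMoment 0 d := fun d hd => hqc ▸ strictAnti_expMoment 0 hd.2
  have hq0 : 0 < q := hq.lt_of_ne (by
    rintro rfl
    simp [expMoment_apply_zero, hc1.ne'] at hqc)
  have hshort : arrivalTime (evenSpeed c 0) (2 * π) < L := by
    have h1c := sub_pos.2 hc1
    rw [show evenSpeed c 0 = fun _ => √(1 - c) * (2 * √(1 / 2 / c)) from
      funext (evenSpeed_zero c), arrivalTime_const, div_lt_iff₀ (by positivity)]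
    refine lt_of_pow_lt_pow_left₀ 2 (by positivity) ?_
    rw [mul_pow, mul_pow, mul_pow, mul_pow, sq_sqrt h1c.le, sq_sqrt (by positivity)]
    field_simp
    linarith
  have hcont : ContinuousOn (fun d => arrivalTime (evenSpeed c d) (2 * π)) (Ico 0 q) :=
    (continuousOn_arrivalTime (continuous_evenSpeed hc.ne') _).mono fun d hd =>
      evenSpeed_pos hd.1 hc (hadm d hd)
  have : (𝓝[Ico 0 q] q).NeBot := by
    rw [nhdsWithin_Ico_eq_nhdsLT hq0]
    infer_instance
  obtain ⟨d, hd, hdL⟩ := isPreconnected_Ico.intermediate_value_Ici (left_mem_Ico.2 hq0)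
    (le_principal_iff.2 self_mem_nhdsWithin) hcont
    (tendsto_arrivalTime_evenSpeed_atTop hqc) hshort.le
  refine ⟨d, hd.1.lt_of_ne ?_, hadm d hd, hdL⟩
  rintro rfl
  exact hshort.ne hdL

/-- The time derivative of the even wave at the moment when its angle is `θ`. The angular speed
contains the value of the wave as a factor, which has cancelled here. -/
noncomputable def evenVelocity (c d θ : ℝ) : ℝ :=
  -(d / 2) * sin θ * √(c / expMoment 0 d * chordGap d ((1 + cos θ) / 2))

lemma continuous_evenVelocity (c d : ℝ) : Continuous (evenVelocity c d) := by
  have := continuous_expMoment 1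
  unfold evenVelocity chordGap
  fun_prop

lemma sin_eq_zero_of_evenVelocity_eq_zero (hd : d ≠ 0) (hc : 0 < c) {θ : ℝ}
    (h : evenVelocity c d θ = 0) : sin θ = 0 := by
  have hroot := sqrt_pos.2 (mul_pos (div_pos hc (expMoment_pos 0 d))
    (chordGap_pos d (one_add_cos_div_two_mem_Icc θ)))
  simpa [evenVelocity, hd, hroot.ne'] using h

lemma sq_evenVelocity (hd : 0 ≤ d) (hc : 0 < c) (h : c < expMoment 0 d) (θ : ℝ) :
    evenVelocity c d θ ^ 2 = evenValue c d θ ^ 2 + c * log (1 - evenValue c d θ ^ 2)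
      + (c / expMoment 0 d - 1 - c * log (c / expMoment 0 d)) := by
  have hA := expMoment_pos 0 d
  have hgap := mul_chordGap d ((1 + cos θ) / 2)
  have hκ : c / expMoment 0 d * (1 - exp (-d)) = c * d := by
    rw [← mul_expMoment_zero]
    field_simp
  rw [evenVelocity, mul_pow, sq_sqrt (mul_pos (div_pos hc hA)
    (chordGap_pos d (one_add_cos_div_two_mem_Icc θ))).le, sq_evenValue hd hc.le h, evenSq,
    sub_sub_cancel, log_mul (div_pos hc hA).ne' (exp_pos _).ne', log_exp]
  linear_combination (c / expMoment 0 d) * hgap - (1 + cos θ) / 2 * hκ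
    + d ^ 2 / 4 * (c / expMoment 0 d) * chordGap d ((1 + cos θ) / 2) * sin_sq θ

lemma hasDerivAt_evenValue_comp {Θ : ℝ → ℝ} (hd : 0 ≤ d) (hc : 0 < c) (h : c < expMoment 0 d)
    (hΘ : IsMotion (evenSpeed c d) Θ) (t : ℝ) :
    HasDerivAt (fun t => evenValue c d (Θ t)) (evenVelocity c d (Θ t)) t := by
  have hsq := evenSq_pos hd hc.le h (one_add_cos_div_two_mem_Icc (Θ t))
  have hκ := div_pos hc (expMoment_pos 0 d)
  have hcos : HasDerivAt (fun t => (1 + cos (Θ t)) / 2)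
      (-sin (Θ t) * evenSpeed c d (Θ t) / 2) t := ((hΘ.hasDerivAt t).cos.const_add 1).div_const 2
  refine (((((hcos.const_mul d).fun_neg.exp).const_mul (c / expMoment 0 d)).const_sub 1).sqrt
    hsq.ne').congr_deriv ?_
  have hne := (evenValue_pos hd hc.le h (Θ t)).ne'
  have hsqrt : √(c / expMoment 0 d * chordGap d ((1 + cos (Θ t)) / 2)) = c / expMoment 0 d
      * √(chordGap d ((1 + cos (Θ t)) / 2) / (c / expMoment 0 d)) := by
    rw [← sqrt_sq hκ.le, ← sqrt_mul (sq_nonneg _), sqrt_sq hκ.le, sq, mul_assoc,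
      mul_div_cancel₀ _ hκ.ne']
  change _ / (2 * evenValue c d (Θ t)) = _
  rw [evenVelocity, hsqrt, evenSpeed, evenSpeedRatio, exp_neg]
  field_simp

lemma isEvenWave_of_isMotion {ω : ℝ} {Θ : ℝ → ℝ} (hd : 0 < d) (hω : ω < 1)
    (h : 1 - ω < expMoment 0 d) (hΘ : IsMotion (evenSpeed (1 - ω) d) Θ) :
    IsEvenWave ω (arrivalTime (evenSpeed (1 - ω) d) (2 * π)) 0
      fun t => evenValue (1 - ω) d (Θ t) := by
  have hc := sub_pos.2 hω
  have hG : Continuous (evenSpeed (1 - ω) d) := (continuous_evenSpeed hc.ne').uncurry_left d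
  have hpos : ∀ θ, 0 < evenSpeed (1 - ω) d θ := evenSpeed_pos hd.le hc h
  have hvalue : ∀ θ, 0 < evenValue (1 - ω) d θ := evenValue_pos hd.le hc.le h
  have hlt : ∀ t, evenValue (1 - ω) d (Θ t) ^ 2 < 1 := fun t =>
    (sq_lt_one_iff₀ (hvalue _).le).2 (evenValue_lt_one hc d _)
  have hzeros : {t | evenVelocity (1 - ω) d (Θ t) = 0}.Countable :=
    (countable_setOf_sin_eq_zero.preimage (hΘ.strictMono hpos).injective).mono fun t ht =>
      sin_eq_zero_of_evenVelocity_eq_zero hd.ne' hc ht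
  have hperiod : HasMinimalPeriod (fun t => evenValue (1 - ω) d (Θ t)) _ :=
    hΘ.hasMinimalPeriod_comp (θ₀ := 0) hG hpos (periodic_evenSpeed _ d) two_pi_pos
      (periodic_evenValue _ d)
      fun θ hθ => evenValue_ne_of_mem_Ioo hd hc h (by rwa [zero_add] at hθ)
  refine ⟨isPeriodicProfile_of_sq_eq ((continuous_evenVelocity _ d).comp hΘ.continuous)
    (hasDerivAt_evenValue_comp hd.le hc h hΘ) hlt (fun t => sq_evenVelocity hd.le hc h (Θ t))
    hzeros hperiod, fun t => ⟨hvalue _, evenValue_lt_one hc d _⟩, fun t => ?_⟩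
  simp only [zero_add, zero_sub, hΘ.apply_neg hG hpos (evenSpeed_neg _ d), evenValue_neg]

lemma exists_isEvenWave {ω : ℝ} (hL : 0 < L) (hω : evenThreshold L < ω) (hω1 : ω < 1) :
    ∃ φ, IsEvenWave ω L 0 φ := by
  have hc := sub_pos.2 hω1
  have hlong : 2 * π ^ 2 * (1 - ω) < (1 - (1 - ω)) * L ^ 2 := by
    rw [evenThreshold, div_lt_iff₀ (by positivity)] at hω
    linarith
  have hω0 : 0 < ω := lt_of_le_of_lt (by unfold evenThreshold; positivity) hω
  obtain ⟨d, hd, hdω, rfl⟩ := exists_arrivalTime_evenSpeed_eq hc (by linarith) hL hlong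
  obtain ⟨Θ, hΘ⟩ := exists_isMotion ((continuous_evenSpeed hc.ne').uncurry_left d)
    (evenSpeed_pos hd.le hc hdω) (periodic_evenSpeed _ d) two_pi_pos
  exact ⟨_, isEvenWave_of_isMotion hd hω1 hdω hΘ⟩

end EvenWave

section Translation

variable {ω L x₀ : ℝ} {φ : ℝ → ℝ}

lemma HasMinimalPeriod.comp_sub_const (h : HasMinimalPeriod φ L) (a : ℝ) :
    HasMinimalPeriod (fun x => φ (x - a)) L := by
  refine ⟨⟨h.1.1, h.1.2.sub_const a⟩, fun T hT => h.2 ⟨hT.1, ?_⟩⟩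
  simpa only [add_sub_cancel_right] using hT.2.add_const a

lemma IsPeriodicProfile.comp_sub_const (h : IsPeriodicProfile ω L φ) (a : ℝ) :
    IsPeriodicProfile ω L fun x => φ (x - a) where
  smooth := h.smooth.comp (contDiff_id.sub contDiff_const)
  period := h.period.comp_sub_const a
  ode x := by
    rw [funext fun x => deriv_comp_sub_const φ a x, deriv_comp_sub_const, h.ode]

lemma IsEvenWave.comp_sub_const (h : IsEvenWave ω L x₀ φ) (a : ℝ) :
    IsEvenWave ω L (x₀ + a) fun x => φ (x - a) where
  toIsPeriodicProfile := h.toIsPeriodicProfile.comp_sub_const a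
  range x := h.range (x - a)
  even x := by
    rw [add_right_comm, add_sub_cancel_right, h.even, add_sub_right_comm, add_sub_cancel_right]

lemma IsOddWave.comp_sub_const (h : IsOddWave ω L x₀ φ) (a : ℝ) :
    IsOddWave ω L (x₀ + a) fun x => φ (x - a) where
  toIsPeriodicProfile := h.toIsPeriodicProfile.comp_sub_const a
  range x := h.range (x - a)
  odd x := by
    rw [add_right_comm, add_sub_cancel_right, h.odd, add_sub_right_comm, add_sub_cancel_right]
  quarter x := by
    rw [add_right_comm, add_sub_cancel_right, h.quarter, add_right_comm, add_sub_cancel_right]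

end Translation

theorem theorem1 (L : ℝ) (hL : 0 < L) :
    (∀ ω : ℝ, evenThreshold L < ω → ω < 1 →
      ∃ φ : ℝ → ℝ, ∀ x₀ : ℝ, IsEvenWave ω L x₀ (fun x => φ (x - x₀))) ∧
    (∀ ω : ℝ, oddThreshold L < ω → ω < 1 →
      ∃ φ : ℝ → ℝ, ∀ x₀ : ℝ, IsOddWave ω L x₀ (fun x => φ (x - x₀))) := by
  refine ⟨fun ω hω hω1 => ?_, fun ω hω hω1 => ?_⟩
  · obtain ⟨φ, hφ⟩ := exists_isEvenWave hL hω hω1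
    exact ⟨φ, fun x₀ => by simpa only [zero_add] using hφ.comp_sub_const x₀⟩
  · obtain ⟨φ, hφ⟩ := exists_isOddWave hL hω hω1
    exact ⟨φ, fun x₀ => by simpa only [zero_add] using hφ.comp_sub_const x₀⟩
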